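/- Let $\Delta=\mathbb{Z}/2\mathbb{Z}$, written multiplicatively with generator $x_0$. For a finite undirected simple graph $\Gamma$ with vertex set $V$, let $G_\Gamma$ be the pro-$2$ right-angled Artin group of $\Gamma$, i.e. the pro-$2$ group with pro-$2$ presentation with generators $x_v$ ($v\in V$) and relators $[x_u,x_v]=x_u^{-1}x_v^{-1}x_ux_v$ for the edges $\{u,v\}$ of $\Gamma$. For a tuple $\mathbf z=(z_v)_{v\in V}$ of elements of $G_\Gamma$, we say that $\mathbf z$ defines an action if there is an action $\delta_{\mathbf z}\colon\Delta\to\mathrm{Aut}(G_\Gamma)$ by continuous automorphisms with $$\delta_{\mathbf z}(x_0)(x_v)=z_v^{-1}x_v^{-1}z_v\qquad\text{for all } v\in V .$$ A $\Delta$-RAAG is a pro-$2$ group isomorphic to $G_\Gamma\rtimes_{\delta_{\mathbf z}}\Delta$ for some finite graph $\Gamma$ and some tuple $\mathbf z$ defining an action. **Theorem.** (1) The class of $\Delta$-RAAGs is stable under nonempty finite coproducts in the category of pro-$2$ groups: every nonempty finite family of $\Delta$-RAAGs has a coproduct in this category, and this coproduct is a $\Delta$-RAAG. (2) Explicitly,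 let $\Gamma_1,\Gamma_2$ be finite graphs with $d_1,d_2$ vertices, let $\mathbf z_1=(z_{11},\dots,z_{1d_1})$ and $\mathbf z_2=(z_{21},\dots,z_{2d_2})$ be tuples in $G_{\Gamma_1}$ and $G_{\Gamma_2}$ defining actions $\delta_{\mathbf z_1}$ and $\delta_{\mathbf z_2}$ of the groups of order two $\langle x_{10}\rangle$ and $\langle x_{20}\rangle$, and let $x_{ij}$ ($1\le j\le d_i$) be the canonical generators of $G_{\Gamma_i}$. Let $\Gamma_0$ be the graph with one vertex, and let $z$ be the corresponding canonical generator of $G_{\Gamma_1\amalg\Gamma_2\amalg\Gamma_0}$, whose canonical generators are $x_{11},\dots,x_{1d_1},x_{21},\dots,x_{2d_2},z$. Then the tuple $$\mathbf z=\bigl(z_{11},\dots,z_{1d_1},\;z_{21}z^{-1},\dots,z_{2d_2}z^{-1},\;1\bigr)$$ of elements of $G_{\Gamma_1\amalg\Gamma_2\amalg\Gamma_0}$ (where $z_{ij}$ denotes its image under the canonical map $G_{\Gamma_i}\to G_{\Gamma_1\amalg\Gamma_2\amalg\Gamma_0}$) defines an action $\delta_{\mathbf z}$, and there is an isomorphism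 of pro-$2$ groups $$G_{\Gamma_1\amalg\Gamma_2\amalg\Gamma_0}\rtimes_{\delta_{\mathbf z}}\langle x_{10}\rangle\;\simeq\;\bigl(G_{\Gamma_1}\rtimes_{\delta_{\mathbf z_1}}\langle x_{10}\rangle\bigr)\amalg\bigl(G_{\Gamma_2}\rtimes_{\delta_{\mathbf z_2}}\langle x_{20}\rangle\bigr)$$ which sends $x_{1i}\mapsto x_{1i}$, $x_{2j}\mapsto x_{2j}$, $x_{10}\mapsto x_{10}$ and $z\mapsto x_{10}x_{20}$. -/

import Mathlib

open CategoryTheory CategoryTheory.Limits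

universe u w

namespace DeltaRAAG

/-! ### The category of pro-2 groups -/

/-- A profinite group is pro-2 if all its quotients by open normal subgroups are 2-groups. -/
def isProTwo : ObjectProperty ProfiniteGrp.{u} :=
  fun G => ∀ U : OpenNormalSubgroup G, IsPGroup 2 (G ⧸ U.toSubgroup)

/-- The category of pro-2 groups and continuous homomorphisms: a full subcategory of
profinite groups. -/
abbrev ProTwoGrp : Type (u + 1) := isProTwo.{u}.FullSubcategory

/-- A pro-2 group, from a compact totally disconnected topological group whose quotients by open
normal subgroups are 2-groups. -/
abbrev ProTwoGrp.of (G : Type u) [Group G] [TopologicalSpace G] [IsTopologicalGroup G]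
    [CompactSpace G] [TotallyDisconnectedSpace G]
    (h : ∀ U : OpenNormalSubgroup G, IsPGroup 2 (G ⧸ U.toSubgroup)) : ProTwoGrp.{u} :=
  ⟨ProfiniteGrp.of G, h⟩

theorem isPGroup_quotient_iff {G : Type u} [Group G] (N : Subgroup G) [N.Normal] :
    IsPGroup 2 (G ⧸ N) ↔ ∀ g : G, ∃ k : ℕ, g ^ 2 ^ k ∈ N := by
  constructor
  · intro h g
    obtain ⟨k, hk⟩ := h (g : G ⧸ N)
    exact ⟨k, (QuotientGroup.eq_one_iff _).1 (by simpa using hk)⟩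
  · intro h g
    induction g using QuotientGroup.induction_on with
    | H g =>
      obtain ⟨k, hk⟩ := h g
      exact ⟨k, by simpa using (QuotientGroup.eq_one_iff _).2 hk⟩

/-! ### The pro-2 completion of a discrete group -/

section Completion

variable (F : Type u) [Group F]

/-- The normal subgroups of `F` whose index is a power of 2. -/
def TwoNormal : Type u := {N : Subgroup F // N.Normal ∧ ∃ k : ℕ, N.index = 2 ^ k}

variable {F}

instance (N : TwoNormal F) : N.1.Normal := N.2.1

/-- The finite 2-group `F ⧸ N`, with the discrete topology. -/
def TwoQuotient (N : TwoNormal F) : Type u := F ⧸ N.1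

instance (N : TwoNormal F) : Group (TwoQuotient N) := inferInstanceAs (Group (F ⧸ N.1))

instance (N : TwoNormal F) : TopologicalSpace (TwoQuotient N) := ⊥

instance (N : TwoNormal F) : DiscreteTopology (TwoQuotient N) := ⟨rfl⟩

theorem TwoQuotient.exists_card (N : TwoNormal F) : ∃ k : ℕ, Nat.card (TwoQuotient N) = 2 ^ k :=
  N.2.2

instance (N : TwoNormal F) : Finite (TwoQuotient N) := by
  obtain ⟨k, hk⟩ := TwoQuotient.exists_card N
  exact Nat.finite_of_card_ne_zero (by rw [hk]; positivity)

/-- The transition homomorphism `F ⧸ N → F ⧸ M` for `N ≤ M`. -/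
def TwoQuotient.transition {N M : TwoNormal F} (h : N.1 ≤ M.1) : TwoQuotient N →* TwoQuotient M :=
  QuotientGroup.map N.1 M.1 (MonoidHom.id F) h

variable (F)

/-- The compatible families, as a subgroup of the product of all `F ⧸ N`. -/
def compatibleFamilies : Subgroup (∀ N : TwoNormal F, TwoQuotient N) where
  carrier := {c | ∀ (N M : TwoNormal F) (h : N.1 ≤ M.1), TwoQuotient.transition h (c N) = c M}
  mul_mem' ha hb N M h := by simp [ha N M h, hb N M h]
  one_mem' N M h := by simp
  inv_mem' ha N M h := by simp [ha N M h]

/-- The pro-2 completion of the discrete group `F`: the inverse limit of the quotients `F ⧸ N` over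
the normal subgroups `N` of 2-power index. -/
def ProTwoCompletion : Type u := compatibleFamilies F

namespace ProTwoCompletion

instance : Group (ProTwoCompletion F) := inferInstanceAs (Group (compatibleFamilies F))

instance : TopologicalSpace (ProTwoCompletion F) :=
  inferInstanceAs (TopologicalSpace (compatibleFamilies F))

instance : IsTopologicalGroup (ProTwoCompletion F) :=
  inferInstanceAs (IsTopologicalGroup (compatibleFamilies F))

instance : TotallyDisconnectedSpace (ProTwoCompletion F) :=
  inferInstanceAs (TotallyDisconnectedSpace (compatibleFamilies F))

theorem isClosed_compatibleFamilies :
    IsClosed (compatibleFamilies F : Set (∀ N : TwoNormal F, TwoQuotient N)) := by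
  have : (compatibleFamilies F : Set (∀ N : TwoNormal F, TwoQuotient N)) =
      ⋂ (N : TwoNormal F) (M : TwoNormal F) (h : N.1 ≤ M.1),
        {c | TwoQuotient.transition h (c N) = c M} := by
    ext c
    simp [compatibleFamilies]
  rw [this]
  refine isClosed_iInter fun N => isClosed_iInter fun M => isClosed_iInter fun h => ?_
  exact isClosed_eq (continuous_of_discreteTopology.comp (continuous_apply N)) (continuous_apply M)

instance : CompactSpace (ProTwoCompletion F) :=
  isCompact_iff_compactSpace.1 (isClosed_compatibleFamilies F).isCompact

variable {F}

/-- The canonical homomorphism from `F` to its pro-2 completion. -/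
def eta : F →* ProTwoCompletion F where
  toFun x := ⟨fun N => (QuotientGroup.mk x : F ⧸ N.1), fun _ _ _ => rfl⟩
  map_one' := rfl
  map_mul' _ _ := rfl

theorem isPGroup (U : OpenNormalSubgroup (ProTwoCompletion F)) :
    IsPGroup 2 (ProTwoCompletion F ⧸ U.toSubgroup) := by
  rw [isPGroup_quotient_iff]
  intro g
  obtain ⟨s, hs, hsU⟩ := isOpen_induced_iff.1 U.isOpen'
  have h1 : (1 : ∀ N : TwoNormal F, TwoQuotient N) ∈ s := by
    have : (1 : ProTwoCompletion F) ∈ (Subtype.val ⁻¹' s : Set (ProTwoCompletion F)) := by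
      rw [hsU]; exact U.toSubgroup.one_mem
    exact this
  obtain ⟨I, v, hv, hIs⟩ := isOpen_pi_iff.1 hs 1 h1
  choose e he using fun N : TwoNormal F => TwoQuotient.exists_card N
  refine ⟨∑ N ∈ I, e N, ?_⟩
  have : (g ^ 2 ^ ∑ N ∈ I, e N : ProTwoCompletion F) ∈
      (Subtype.val ⁻¹' s : Set (ProTwoCompletion F)) := by
    refine hIs fun N hN => ?_
    have hdvd : Nat.card (TwoQuotient N) ∣ 2 ^ ∑ N ∈ I, e N := by
      rw [he]
      exact pow_dvd_pow 2 (Finset.single_le_sum (f := e) (fun _ _ => Nat.zero_le _) hN)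
    have : (g.1 N) ^ 2 ^ ∑ N ∈ I, e N = 1 :=
      orderOf_dvd_iff_pow_eq_one.1 ((orderOf_dvd_natCard _).trans hdvd)
    have h2 : (g ^ 2 ^ ∑ N ∈ I, e N : ProTwoCompletion F).1 N = 1 := this
    rw [h2]
    exact (hv N hN).2
  rw [hsU] at this
  exact this

variable {E : Type u} [Group E]

/-- The preimage of a normal subgroup of 2-power index. -/
def comapTwoNormal (f : F →* E) (N : TwoNormal E) : TwoNormal F :=
  ⟨N.1.comap f, inferInstance, by
    obtain ⟨k, hk⟩ := N.2.2
    have h : (N.1.comap f).index ∣ 2 ^ k := by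
      rw [Subgroup.index_comap, ← hk]
      exact Subgroup.relIndex_dvd_index_of_normal _ _
    obtain ⟨j, -, hj⟩ := (Nat.dvd_prime_pow Nat.prime_two).1 h
    exact ⟨j, hj⟩⟩

/-- The map `F ⧸ f⁻¹(N) → E ⧸ N` induced by `f`. -/
def quotientMap (f : F →* E) (N : TwoNormal E) :
    TwoQuotient (comapTwoNormal f N) →* TwoQuotient N :=
  QuotientGroup.map (N.1.comap f) N.1 f le_rfl

/-- The continuous homomorphism of pro-2 completions induced by a homomorphism. -/
def map (f : F →* E) : ProTwoCompletion F →ₜ* ProTwoCompletion E where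
  toFun c := ⟨fun N => quotientMap f N (c.1 (comapTwoNormal f N)), by
    intro N M h
    have hc := c.2 (comapTwoNormal f N) (comapTwoNormal f M) (Subgroup.comap_mono h)
    change TwoQuotient.transition h (quotientMap f N (c.1 (comapTwoNormal f N))) =
      quotientMap f M (c.1 (comapTwoNormal f M))
    refine Eq.trans ?_ (congrArg (quotientMap f M) hc)
    generalize c.1 (comapTwoNormal f N) = q
    induction q using QuotientGroup.induction_on with
    | H q => rfl⟩
  map_one' := Subtype.ext (funext fun N => map_one (quotientMap f N))
  map_mul' a b := Subtype.ext (funext fun N => map_mul (quotientMap f N) _ _)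
  continuous_toFun := by
    refine Continuous.subtype_mk (continuous_pi fun N => ?_) _
    exact continuous_of_discreteTopology.comp
      ((continuous_apply (comapTwoNormal f N)).comp continuous_subtype_val)

theorem map_eta (f : F →* E) (x : F) : map f (eta x) = eta (f x) := rfl

end ProTwoCompletion

end Completion

/-! ### Pro-2 right-angled Artin groups -/

section RAAG

/-- The free pro-2 group on a finite set `V`: the pro-2 completion of the free group on `V`. -/
abbrev FreeProTwo (V : Type u) : Type u := ProTwoCompletion (FreeGroup V)

/-- The canonical generators of the free pro-2 group. -/
def FreeProTwo.gen {V : Type u} (v : V) : FreeProTwo V := ProTwoCompletion.eta (FreeGroup.of v)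

variable {V : Type u} (Γ : SimpleGraph V)

/-- The closed normal subgroup of the free pro-2 group generated by the commutators
`[x_u, x_v] = x_u⁻¹ x_v⁻¹ x_u x_v` for the edges `{u, v}`. -/
def relators : Subgroup (FreeProTwo V) :=
  (Subgroup.normalClosure {r | ∃ u v : V, Γ.Adj u v ∧
    r = (FreeProTwo.gen u)⁻¹ * (FreeProTwo.gen v)⁻¹ * FreeProTwo.gen u * FreeProTwo.gen v}
    ).topologicalClosure

instance : (relators Γ).Normal := Subgroup.is_normal_topologicalClosure _

theorem isClosed_relators : IsClosed (relators Γ : Set (FreeProTwo V)) :=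
  Subgroup.isClosed_topologicalClosure _

/-- The pro-2 right-angled Artin group `G_Γ`: the group with pro-2 presentation with generators
`x_v`, `v ∈ V`, and relators `[x_u, x_v]` for the edges `{u, v}` of `Γ`. -/
def RAAG : Type u := FreeProTwo V ⧸ relators Γ

namespace RAAG

instance : Group (RAAG Γ) := inferInstanceAs (Group (FreeProTwo V ⧸ relators Γ))

instance : TopologicalSpace (RAAG Γ) :=
  inferInstanceAs (TopologicalSpace (FreeProTwo V ⧸ relators Γ))

instance : IsTopologicalGroup (RAAG Γ) :=
  inferInstanceAs (IsTopologicalGroup (FreeProTwo V ⧸ relators Γ))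

instance : CompactSpace (RAAG Γ) := inferInstanceAs (CompactSpace (FreeProTwo V ⧸ relators Γ))

/-- The projection from the free pro-2 group. -/
def mk : FreeProTwo V →ₜ* RAAG Γ where
  toMonoidHom := QuotientGroup.mk' (relators Γ)
  continuous_toFun := QuotientGroup.continuous_mk

theorem mk_surjective : Function.Surjective (mk Γ) := QuotientGroup.mk'_surjective _

theorem mk_eq_one {x : FreeProTwo V} : mk Γ x = 1 ↔ x ∈ relators Γ := QuotientGroup.eq_one_iff x

theorem isOpenMap_mk : IsOpenMap (mk Γ) := QuotientGroup.isOpenMap_coe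

instance : TotallyDisconnectedSpace (RAAG Γ) := by
  have key : ∀ x : RAAG Γ, x ≠ 1 → ∃ U : OpenSubgroup (RAAG Γ), x ∉ U := by
    intro x hx
    obtain ⟨y, rfl⟩ := mk_surjective Γ x
    have hy : y ∉ relators Γ := fun h => hx ((mk_eq_one Γ).2 h)
    have hcl := ProfiniteGrp.closedSubgroup_eq_sInf_open
      (⟨relators Γ, isClosed_relators Γ⟩ : ClosedSubgroup (FreeProTwo V))
    change relators Γ = _ at hcl
    rw [hcl, Subgroup.mem_sInf] at hy
    push Not at hy
    obtain ⟨N, ⟨hNo, hN⟩, hyN⟩ := hy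
    refine ⟨⟨N.map (mk Γ).toMonoidHom, isOpenMap_mk Γ _ hNo⟩, ?_⟩
    rintro ⟨w, hw, hwy⟩
    apply hyN
    have h1 : w⁻¹ * y ∈ relators Γ := by
      rw [← mk_eq_one, map_mul, map_inv]
      have : mk Γ w = mk Γ y := hwy
      rw [this]; simp
    have h2 : w⁻¹ * y ∈ N := hN h1
    simpa using N.mul_mem hw h2
  have : TotallySeparatedSpace (RAAG Γ) := by
    rw [totallySeparatedSpace_iff_exists_isClopen]
    intro x y hxy
    obtain ⟨U, hU⟩ := key (x⁻¹ * y) (by simpa [inv_mul_eq_one] using hxy)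
    refine ⟨(fun t => x⁻¹ * t) ⁻¹' (U : Set (RAAG Γ)),
      U.isClopen.preimage (continuous_const_mul _), ?_, hU⟩
    simp
  infer_instance

theorem isPGroup (U : OpenNormalSubgroup (RAAG Γ)) : IsPGroup 2 (RAAG Γ ⧸ U.toSubgroup) := by
  rw [isPGroup_quotient_iff]
  intro x
  obtain ⟨y, rfl⟩ := mk_surjective Γ x
  let W : OpenNormalSubgroup (FreeProTwo V) :=
    { toSubgroup := U.toSubgroup.comap (mk Γ).toMonoidHom
      isOpen' := U.isOpen'.preimage (mk Γ).continuous_toFun }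
  obtain ⟨k, hk⟩ := (isPGroup_quotient_iff _).1 (ProTwoCompletion.isPGroup W) y
  exact ⟨k, by rw [← map_pow]; exact hk⟩

variable {Γ}

/-- The canonical generators `x_v` of `G_Γ`. -/
def gen (v : V) : RAAG Γ := mk Γ (FreeProTwo.gen v)

variable {W : Type u} {Λ : SimpleGraph W}

theorem relators_le_ker (f : Γ →g Λ) :
    relators Γ ≤
      ((mk Λ).toMonoidHom.comp (ProTwoCompletion.map (FreeGroup.map f)).toMonoidHom).ker := by
  have hcont : Continuous
      ((mk Λ).toMonoidHom.comp (ProTwoCompletion.map (FreeGroup.map f)).toMonoidHom) :=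
    (mk Λ).continuous_toFun.comp (ProTwoCompletion.map (FreeGroup.map f)).continuous_toFun
  refine Subgroup.topologicalClosure_minimal _ ?_ (isClosed_singleton.preimage hcont)
  refine Subgroup.normalClosure_le_normal ?_
  rintro _ ⟨u, v, huv, rfl⟩
  refine (mk_eq_one Λ).2 (Subgroup.le_topologicalClosure _ (Subgroup.subset_normalClosure ?_))
  refine ⟨f u, f v, f.map_adj huv, ?_⟩
  simp only [FreeProTwo.gen, ← map_inv, ← map_mul]
  exact (ProTwoCompletion.map_eta _ _).trans (by simp)

/-- The continuous homomorphism `G_Γ → G_Λ`, `x_v ↦ x_{f(v)}`, induced by a graph homomorphism. -/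
def map (f : Γ →g Λ) : RAAG Γ →ₜ* RAAG Λ where
  toMonoidHom := QuotientGroup.lift (relators Γ) _ (relators_le_ker f)
  continuous_toFun := by
    refine Continuous.quotient_lift ?_ _
    exact (mk Λ).continuous_toFun.comp (ProTwoCompletion.map (FreeGroup.map f)).continuous_toFun

theorem map_gen (f : Γ →g Λ) (v : V) : map f (gen v) = gen (f v) := by
  change mk Λ (ProTwoCompletion.map (FreeGroup.map f) (ProTwoCompletion.eta (FreeGroup.of v))) = _
  rw [ProTwoCompletion.map_eta, FreeGroup.map.of]
  rfl

end RAAG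

end RAAG

/-! ### Δ-RAAGs -/

/-- The group `Δ = ℤ/2ℤ`, written multiplicatively, with the discrete topology. -/
abbrev Delta : Type := Multiplicative (ZMod 2)

/-- The generator of `Δ`. -/
def x₀ : Delta := Multiplicative.ofAdd 1

section Semidirect

variable {N : Type u} [Group N] [TopologicalSpace N] (δ : Delta →* MulAut N)

/-- The product topology on a semidirect product. -/
instance : TopologicalSpace (N ⋊[δ] Delta) :=
  TopologicalSpace.induced SemidirectProduct.equivProd inferInstance

/-- A semidirect product is homeomorphic to the product. -/
def homeoProd : N ⋊[δ] Delta ≃ₜ N × Delta :=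
  SemidirectProduct.equivProd.toHomeomorphOfIsInducing ⟨rfl⟩

instance [CompactSpace N] : CompactSpace (N ⋊[δ] Delta) := (homeoProd δ).symm.compactSpace

instance [TotallyDisconnectedSpace N] : TotallyDisconnectedSpace (N ⋊[δ] Delta) :=
  (homeoProd δ).symm.totallyDisconnectedSpace

theorem continuous_left : Continuous (fun g : N ⋊[δ] Delta => g.left) :=
  continuous_fst.comp (homeoProd δ).continuous

theorem continuous_right : Continuous (fun g : N ⋊[δ] Delta => g.right) :=
  continuous_snd.comp (homeoProd δ).continuous

theorem continuous_inl : Continuous (SemidirectProduct.inl : N →* N ⋊[δ] Delta) :=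
  continuous_induced_rng.2 (continuous_id.prodMk continuous_const)

variable {δ}

theorem continuous_action (hδ : ∀ d, Continuous (δ d)) :
    Continuous (fun p : Delta × N => δ p.1 p.2) :=
  continuous_prod_of_discrete_left.2 hδ

theorem isTopologicalGroup [IsTopologicalGroup N] (hδ : ∀ d, Continuous (δ d)) :
    IsTopologicalGroup (N ⋊[δ] Delta) where
  continuous_mul := by
    refine continuous_induced_rng.2 (Continuous.prodMk ?_ ?_)
    · exact ((continuous_left δ).comp continuous_fst).mul ((continuous_action hδ).comp
        (((continuous_right δ).comp continuous_fst).prodMk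
          ((continuous_left δ).comp continuous_snd)))
    · exact ((continuous_right δ).comp continuous_fst).mul
        ((continuous_right δ).comp continuous_snd)
  continuous_inv := by
    refine continuous_induced_rng.2 (Continuous.prodMk ?_ ?_)
    · exact (continuous_action hδ).comp
        ((continuous_right δ).inv.prodMk (continuous_left δ).inv)
    · exact (continuous_right δ).inv

theorem isPGroup_semidirect (hN : ∀ U : OpenNormalSubgroup N, IsPGroup 2 (N ⧸ U.toSubgroup))
    (U : OpenNormalSubgroup (N ⋊[δ] Delta)) : IsPGroup 2 ((N ⋊[δ] Delta) ⧸ U.toSubgroup) := by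
  rw [isPGroup_quotient_iff]
  intro g
  let W : OpenNormalSubgroup N :=
    { toSubgroup := U.toSubgroup.comap SemidirectProduct.inl
      isOpen' := U.isOpen'.preimage (continuous_inl δ) }
  have hr : ∀ d : Delta, d * d = 1 := by decide
  have hg : g ^ 2 = SemidirectProduct.inl (g ^ 2).left := by
    ext
    · simp
    · simp [pow_two, hr]
  obtain ⟨k, hk⟩ := (isPGroup_quotient_iff _).1 (hN W) (g ^ 2).left
  refine ⟨k + 1, ?_⟩
  rw [pow_succ', pow_mul, hg, ← map_pow]
  exact hk

end Semidirect

/-- `IsDeltaAction Γ z δ`: the action `δ` of `Δ` on the pro-2 group `G_Γ` (by continuous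
automorphisms) is the action `δ_z`, i.e. `δ(x₀)(x_i) = z_i⁻¹ x_i⁻¹ z_i` for all vertices `i`. -/
structure IsDeltaAction {V : Type u} (Γ : SimpleGraph V) (z : V → RAAG Γ)
    (δ : Delta →* MulAut (RAAG Γ)) : Prop where
  continuous_apply : ∀ d, Continuous (δ d)
  conj : ∀ i, δ x₀ (RAAG.gen i) = (z i)⁻¹ * (RAAG.gen i)⁻¹ * z i

/-- The pro-2 group `G_z = G_Γ ⋊_{δ_z} Δ`. -/
def semidirect {V : Type u} {Γ : SimpleGraph V} {z : V → RAAG Γ} {δ : Delta →* MulAut (RAAG Γ)}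
    (h : IsDeltaAction Γ z δ) : ProTwoGrp.{u} :=
  haveI := isTopologicalGroup h.continuous_apply
  ProTwoGrp.of (RAAG Γ ⋊[δ] Delta) (isPGroup_semidirect (RAAG.isPGroup Γ))

/-- The inclusion `G_Γ → G_Γ ⋊ Δ`. -/
def ofRAAG {V : Type u} {Γ : SimpleGraph V} {z : V → RAAG Γ} {δ : Delta →* MulAut (RAAG Γ)}
    (h : IsDeltaAction Γ z δ) : RAAG Γ →* (semidirect h).obj :=
  (SemidirectProduct.inl : RAAG Γ →* RAAG Γ ⋊[δ] Delta)

/-- The inclusion `Δ → G_Γ ⋊ Δ`. -/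
def ofDelta {V : Type u} {Γ : SimpleGraph V} {z : V → RAAG Γ} {δ : Delta →* MulAut (RAAG Γ)}
    (h : IsDeltaAction Γ z δ) : Delta →* (semidirect h).obj :=
  (SemidirectProduct.inr : Delta →* RAAG Γ ⋊[δ] Delta)

/-- A pro-2 group is a Δ-RAAG if it is isomorphic to some `G_Γ ⋊_{δ_z} Δ`, for a finite graph `Γ`,
a tuple `z` of elements of `G_Γ` indexed by the vertices, and an action `δ_z` as above. -/
def IsDeltaRAAG (G : ProTwoGrp.{u}) : Prop :=
  ∃ (V : Type u) (_ : Finite V) (Γ : SimpleGraph V) (z : V → RAAG Γ)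
    (δ : Delta →* MulAut (RAAG Γ)) (h : IsDeltaAction Γ z δ), Nonempty (G ≅ semidirect h)

section Coproduct

variable {V₁ V₂ : Type u} (Γ₁ : SimpleGraph V₁) (Γ₂ : SimpleGraph V₂)

/-- The disjoint union of `Γ₁`, `Γ₂` and the graph with one vertex. -/
abbrev unionGraph : SimpleGraph ((V₁ ⊕ V₂) ⊕ PUnit.{u + 1}) :=
  (Γ₁ ⊕g Γ₂) ⊕g (⊥ : SimpleGraph PUnit.{u + 1})

/-- The inclusion of `Γ₁` in the disjoint union. -/
def inclOne : Γ₁ →g unionGraph Γ₁ Γ₂ where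
  toFun v := Sum.inl (Sum.inl v)
  map_rel' h := h

/-- The inclusion of `Γ₂` in the disjoint union. -/
def inclTwo : Γ₂ →g unionGraph Γ₁ Γ₂ where
  toFun v := Sum.inl (Sum.inr v)
  map_rel' h := h

/-- The generator of `G_{Γ₁ ∐ Γ₂ ∐ Γ₀}` given by the vertex of `Γ₀`. -/
def newGen : RAAG (unionGraph Γ₁ Γ₂) := RAAG.gen (Sum.inr PUnit.unit)

variable {Γ₁ Γ₂}

/-- The tuple `(z₁₁, …, z₁d₁, z₂₁ z⁻¹, …, z₂d₂ z⁻¹, 1)`, where `z` is the new generator. -/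
def coprodTuple (z₁ : V₁ → RAAG Γ₁) (z₂ : V₂ → RAAG Γ₂) :
    (V₁ ⊕ V₂) ⊕ PUnit.{u + 1} → RAAG (unionGraph Γ₁ Γ₂)
  | Sum.inl (Sum.inl i) => RAAG.map (inclOne Γ₁ Γ₂) (z₁ i)
  | Sum.inl (Sum.inr j) => RAAG.map (inclTwo Γ₁ Γ₂) (z₂ j) * (newGen Γ₁ Γ₂)⁻¹
  | Sum.inr _ => 1

end Coproduct

end DeltaRAAG

/-! Both sides of the isomorphism represent the same functor on pro-2 groups. A morphism `G_Γ ⋊ Δ →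
T` amounts to a family in `T` that commutes along the edges of `Γ`, together with an element `t`
with `t² = 1` that conjugates the image of each generator as `δ(x₀)` prescribes (`RAAG.exists_lift`,
`RAAG.hom_ext`, `exists_semidirect_desc`, `semidirect_hom_ext`).

In the coproduct put `z = x₁₀x₂₀`, so that `x₂₀ = x₁₀z` and `x₁₀ = zx₂₀`. Given `x₁₀² = 1`, the
relation `x₂₀² = 1` says that `x₁₀` inverts `z`, which is the entry `1` of the tuple. That `x₂₀`
acts on `G_{Γ₂}` through `δ₂` says that `x₁₀` acts there by `g ↦ z δ₂(g) z⁻¹`, which is the entry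
`z₂ⱼz⁻¹`. Thus `z` is a free extra generator and the data match (`exists_isColimit_binaryCofan`).
The same formulas show that the tuple defines an involution (`exists_coprod_action`). Finite
families follow by induction from the binary case. -/

namespace DeltaRAAG

/-! ### Universal property of the pro-2 completion. -/

section CompletionLift

variable {F : Type u} [Group F]

/-- Directedness of the system of quotients: `[F : N ∩ M] = [M : N ∩ M][F : M]`, and the first
factor divides `[F : N]`. -/
theorem TwoNormal.exists_le_of_finset (I : Finset (TwoNormal F)) :
    ∃ M : TwoNormal F, ∀ N ∈ I, M.1 ≤ N.1 := by
  classical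
  induction I using Finset.induction_on with
  | empty => exact ⟨⟨⊤, inferInstance, 0, by simp⟩, by simp⟩
  | insert N I _ ih =>
    obtain ⟨M, hM⟩ := ih
    obtain ⟨a, ha⟩ := N.2.2
    obtain ⟨b, hb⟩ := M.2.2
    have hdvd : N.1.relIndex M.1 ∣ 2 ^ a := by
      rw [← ha]
      exact Subgroup.relIndex_dvd_index_of_normal _ _
    obtain ⟨c, -, hc⟩ := (Nat.dvd_prime_pow Nat.prime_two).1 hdvd
    refine ⟨⟨N.1 ⊓ M.1, inferInstance, c + b, ?_⟩, ?_⟩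
    · rw [← Subgroup.relIndex_mul_index (inf_le_right : N.1 ⊓ M.1 ≤ M.1),
        Subgroup.inf_relIndex_right, hc, hb, pow_add]
    · intro K hK
      rcases Finset.mem_insert.1 hK with rfl | hK
      · exact inf_le_left
      · exact inf_le_right.trans (hM K hK)

namespace ProTwoCompletion

instance : T2Space (ProTwoCompletion F) := inferInstanceAs (T2Space (compatibleFamilies F))

/-- A basic open set constrains finitely many coordinates, all determined by the coordinate at one
smaller `M`, and `F → F ⧸ M` is onto. -/
theorem denseRange_eta : DenseRange (eta : F →* ProTwoCompletion F) := by
  refine dense_iff_inter_open.2 ?_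
  rintro U hU ⟨c, hc⟩
  obtain ⟨s, hs, rfl⟩ := isOpen_induced_iff.1 hU
  obtain ⟨I, v, hv, hIs⟩ := isOpen_pi_iff.1 hs c.1 hc
  obtain ⟨M, hM⟩ := TwoNormal.exists_le_of_finset I
  obtain ⟨x, hx⟩ := QuotientGroup.mk'_surjective M.1 (c.1 M)
  refine ⟨eta x, hIs fun N hN => ?_, x, rfl⟩
  have h : (eta x).1 N = c.1 N := by
    rw [← c.2 M N (hM N hN), ← (eta x).2 M N (hM N hN)]
    exact congrArg _ hx
  rw [h]
  exact (hv N hN).2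

theorem isOpen_coordinate_eq_one (N : TwoNormal F) :
    IsOpen {c : ProTwoCompletion F | c.1 N = 1} :=
  (isOpen_discrete ({1} : Set (TwoQuotient N))).preimage
    ((continuous_apply N).comp continuous_subtype_val)

variable {H : Type u} [Group H] [TopologicalSpace H] [IsTopologicalGroup H] [CompactSpace H]
  [TotallyDisconnectedSpace H]

/-- The lift is constructed through its graph: the closure `K` of the pairs `(eta x, φ x)` is
compact and projects bijectively to the completion, hence homeomorphically. -/
theorem exists_lift (hH : ∀ U : OpenNormalSubgroup H, IsPGroup 2 (H ⧸ U.toSubgroup))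
    (φ : F →* H) : ∃ ψ : ProTwoCompletion F →ₜ* H, ∀ x, ψ (eta x) = φ x := by
  let K : Subgroup (ProTwoCompletion F × H) := (eta.prod φ).range.topologicalClosure
  have hKc : CompactSpace K :=
    isCompact_iff_compactSpace.1 (Subgroup.isClosed_topologicalClosure _).isCompact
  have hmem : ∀ x, (eta x, φ x) ∈ K := fun x =>
    Subgroup.le_topologicalClosure _ ⟨x, rfl⟩
  let p : K →* ProTwoCompletion F := (MonoidHom.fst _ _).comp K.subtype
  have hp : Continuous p := continuous_fst.comp continuous_subtype_val
  have hsurj : Function.Surjective p := by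
    rw [← Set.range_eq_univ, ← (isCompact_range hp).isClosed.closure_eq]
    refine Dense.closure_eq (denseRange_eta.mono ?_)
    rintro _ ⟨x, rfl⟩
    exact ⟨⟨_, hmem x⟩, rfl⟩
  have hinj : Function.Injective p := by
    rw [injective_iff_map_eq_one]
    rintro ⟨⟨c, h⟩, hk⟩ (rfl : c = 1)
    by_contra hne
    have hh : h ≠ 1 := fun hh => hne (Subtype.ext (Prod.ext rfl hh))
    -- Suppose `(1, h) ∈ K` with `h ≠ 1`, and choose `U` avoiding `h`. The preimage `φ⁻¹(U)` has
    -- 2-power index, so a graph point near `(1, h)` satisfies both `φ x ∈ U` and `φ x ≡ h` modulo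
    -- `U`, forcing `h ∈ U`.
    obtain ⟨U, hU⟩ := ProfiniteGrp.exist_openNormalSubgroup_sub_open_nhds_of_one
      (G := H) (isOpen_compl_singleton (x := h)) (Ne.symm hh)
    have hfin : Finite (H ⧸ U.toSubgroup) := Subgroup.quotient_finite_of_isOpen _ U.isOpen'
    let T : TwoNormal H := ⟨U.toSubgroup, inferInstance, IsPGroup.iff_card.1 (hH U)⟩
    let W : Set (ProTwoCompletion F × H) :=
      {c | c.1 (comapTwoNormal φ T) = 1} ×ˢ {y | y⁻¹ * h ∈ U.toSubgroup}
    have hW : IsOpen W := (isOpen_coordinate_eq_one _).prod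
      (U.isOpen'.preimage (continuous_inv.mul continuous_const))
    obtain ⟨_, ⟨hx1, hx2⟩, x, rfl⟩ := mem_closure_iff.1 hk W hW
      ⟨rfl, show h⁻¹ * h ∈ U.toSubgroup by simp⟩
    have hx1 : φ x ∈ U.toSubgroup := (QuotientGroup.eq_one_iff x).1 hx1
    have hx2 : (φ x)⁻¹ * h ∈ U.toSubgroup := hx2
    have : h ∈ U.toSubgroup := by simpa using U.toSubgroup.mul_mem hx1 hx2
    exact hU this rfl
  let e : K ≃* ProTwoCompletion F := MulEquiv.ofBijective p ⟨hinj, hsurj⟩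
  have he : Continuous e.symm :=
    (Continuous.homeoOfEquivCompactToT2 (f := e.toEquiv) hp).symm.continuous
  refine ⟨⟨(MonoidHom.snd _ _).comp (K.subtype.comp e.symm.toMonoidHom),
    continuous_snd.comp (continuous_subtype_val.comp he)⟩, fun x => ?_⟩
  have : e.symm (eta x) = ⟨_, hmem x⟩ := by
    rw [MulEquiv.symm_apply_eq]
    rfl
  exact congrArg (fun k : K => k.1.2) this

theorem hom_ext {M : Type*} [Monoid M] [TopologicalSpace M] [T2Space M]
    {φ ψ : ProTwoCompletion F →ₜ* M} (h : ∀ x, φ (eta x) = ψ (eta x)) : φ = ψ :=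
  DFunLike.coe_injective
    (denseRange_eta.equalizer φ.continuous_toFun ψ.continuous_toFun (funext h))

end ProTwoCompletion

end CompletionLift

/-! ### Universal property of the pro-2 RAAG. -/

namespace RAAG

variable {V : Type u} {Γ : SimpleGraph V}

theorem gen_commute {u v : V} (h : Γ.Adj u v) : Commute (gen u : RAAG Γ) (gen v) := by
  have : (gen u : RAAG Γ)⁻¹ * (gen v)⁻¹ * gen u * gen v = 1 := by
    simp only [gen, ← map_inv, ← map_mul]
    exact (mk_eq_one Γ).2 (Subgroup.le_topologicalClosure _
      (Subgroup.subset_normalClosure ⟨u, v, h, rfl⟩))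
  rw [mul_assoc, ← mul_inv_rev, inv_mul_eq_one] at this
  exact this.symm

/-- The kernel of the lift to the free pro-2 group is closed and normal, so it contains `relators Γ`
once it contains the edge commutators. -/
theorem exists_lift {H : Type u} [Group H] [TopologicalSpace H] [IsTopologicalGroup H]
    [CompactSpace H] [TotallyDisconnectedSpace H]
    (hH : ∀ U : OpenNormalSubgroup H, IsPGroup 2 (H ⧸ U.toSubgroup)) (f : V → H)
    (hf : ∀ u v, Γ.Adj u v → Commute (f u) (f v)) :
    ∃ φ : RAAG Γ →ₜ* H, ∀ v, φ (gen v) = f v := by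
  obtain ⟨ψ, hψ⟩ := ProTwoCompletion.exists_lift hH (FreeGroup.lift f)
  have hgen : ∀ v, ψ (FreeProTwo.gen v) = f v := fun v => (hψ _).trans (by simp)
  have hker : relators Γ ≤ ψ.toMonoidHom.ker := by
    refine Subgroup.topologicalClosure_minimal _ (Subgroup.normalClosure_le_normal ?_)
      (isClosed_singleton.preimage ψ.continuous_toFun)
    rintro _ ⟨u, v, huv, rfl⟩
    change ψ _ = 1
    rw [map_mul, map_mul, map_mul, map_inv, map_inv, hgen, hgen, mul_assoc, ← mul_inv_rev,
      inv_mul_eq_one]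
    exact (hf u v huv).symm
  exact ⟨⟨QuotientGroup.lift (relators Γ) ψ.toMonoidHom hker,
    Continuous.quotient_lift ψ.continuous_toFun _⟩, hgen⟩

theorem hom_ext {H : Type*} [Group H] [TopologicalSpace H] [T2Space H]
    {φ ψ : RAAG Γ →ₜ* H} (h : ∀ v, φ (gen v) = ψ (gen v)) : φ = ψ := by
  have key : φ.comp (mk Γ) = ψ.comp (mk Γ) := by
    refine ProTwoCompletion.hom_ext fun x => ?_
    refine DFunLike.congr_fun (f := (φ.comp (mk Γ)).toMonoidHom.comp ProTwoCompletion.eta)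
      (g := (ψ.comp (mk Γ)).toMonoidHom.comp ProTwoCompletion.eta) (FreeGroup.ext_hom _ _ h) x
  ext g
  obtain ⟨y, rfl⟩ := mk_surjective Γ g
  exact DFunLike.congr_fun key y

end RAAG

/-! ### Actions of the group of order two. -/

theorem Delta.eq_one_or_eq (d : Delta) : d = 1 ∨ d = x₀ := by
  revert d
  decide

theorem x₀_mul_x₀ : x₀ * x₀ = 1 := by decide

/-- The homomorphism from `Δ` given by an element of order dividing 2. -/
def Delta.lift {M : Type*} [Monoid M] (t : M) (ht : t * t = 1) : Delta →* M where
  toFun d := if d = 1 then 1 else t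
  map_one' := by simp
  map_mul' a b := by
    have h : x₀ ≠ 1 := by decide
    rcases Delta.eq_one_or_eq a with rfl | rfl <;> rcases Delta.eq_one_or_eq b with rfl | rfl <;>
      simp [h, x₀_mul_x₀, ht]

theorem Delta.lift_x₀ {M : Type*} [Monoid M] (t : M) (ht : t * t = 1) :
    Delta.lift t ht x₀ = t :=
  if_neg (c := x₀ = 1) (t := (1 : M)) (by decide)

/-- Conjugation by an element of a topological group, as a continuous homomorphism. -/
def conjHom {G : Type*} [Group G] [TopologicalSpace G] [IsTopologicalGroup G] (g : G) :
    G →ₜ* G where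
  toMonoidHom := (MulAut.conj g).toMonoidHom
  continuous_toFun := (continuous_const.mul continuous_id).mul continuous_const

theorem conjHom_apply {G : Type*} [Group G] [TopologicalSpace G] [IsTopologicalGroup G] (g x : G) :
    conjHom g x = g * x * g⁻¹ := rfl

/-- By `RAAG.hom_ext`, `σ² = id` need only be checked on generators; `σ` is then its own inverse. -/
theorem exists_action_of_involution {V : Type u} {Γ : SimpleGraph V} {z : V → RAAG Γ}
    (σ : RAAG Γ →ₜ* RAAG Γ) (hσ : ∀ v, σ (RAAG.gen v) = (z v)⁻¹ * (RAAG.gen v)⁻¹ * z v)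
    (hσσ : ∀ v, σ (σ (RAAG.gen v)) = RAAG.gen v) : ∃ δ, IsDeltaAction Γ z δ := by
  have h : σ.comp σ = ContinuousMonoidHom.id _ := RAAG.hom_ext hσσ
  have h' : ∀ g, σ (σ g) = g := DFunLike.congr_fun h
  let s : MulAut (RAAG Γ) :=
    { toFun := σ, invFun := σ, left_inv := h', right_inv := h', map_mul' := map_mul σ }
  have hs : s * s = 1 := MulEquiv.ext h'
  refine ⟨Delta.lift s hs, fun d => ?_, fun v => ?_⟩
  · rcases Delta.eq_one_or_eq d with rfl | rfl
    · rw [map_one]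
      exact continuous_id
    · rw [Delta.lift_x₀]
      exact σ.continuous_toFun
  · rw [Delta.lift_x₀]
    exact hσ v

namespace IsDeltaAction

variable {V : Type u} {Γ : SimpleGraph V} {z : V → RAAG Γ} {δ : Delta →* MulAut (RAAG Γ)}

/-- The automorphism `δ(x₀)`, as a continuous homomorphism. -/
def toHom (h : IsDeltaAction Γ z δ) : RAAG Γ →ₜ* RAAG Γ where
  toMonoidHom := (δ x₀).toMonoidHom
  continuous_toFun := h.continuous_apply x₀

theorem toHom_gen (h : IsDeltaAction Γ z δ) (v : V) :
    h.toHom (RAAG.gen v) = (z v)⁻¹ * (RAAG.gen v)⁻¹ * z v := h.conj v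

theorem toHom_toHom (h : IsDeltaAction Γ z δ) (g : RAAG Γ) : h.toHom (h.toHom g) = g := by
  change (δ x₀ * δ x₀) g = g
  rw [← map_mul, x₀_mul_x₀, map_one]
  rfl

end IsDeltaAction

/-! ### Morphisms out of the semidirect product. -/

section Extension

variable {V : Type u} {Γ : SimpleGraph V} {z : V → RAAG Γ} {δ : Delta →* MulAut (RAAG Γ)}

/-- The inclusion `G_Γ → G_Γ ⋊ Δ`, as a continuous homomorphism. -/
def ofRAAGHom (h : IsDeltaAction Γ z δ) : RAAG Γ →ₜ* (semidirect h).obj where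
  toMonoidHom := ofRAAG h
  continuous_toFun := continuous_inl δ

theorem ofDelta_conj (h : IsDeltaAction Γ z δ) (g : RAAG Γ) :
    ofDelta h x₀ * ofRAAG h g * (ofDelta h x₀)⁻¹ = ofRAAG h (h.toHom g) := by
  rw [← map_inv]
  exact (SemidirectProduct.inl_aut x₀ g).symm

theorem ofDelta_mul_self (h : IsDeltaAction Γ z δ) : ofDelta h x₀ * ofDelta h x₀ = 1 := by
  rw [← map_mul, x₀_mul_x₀, map_one]

/-- The underlying continuous homomorphism of a morphism of pro-2 groups. -/
abbrev toCont {G H : ProTwoGrp.{u}} (f : G ⟶ H) : G.obj →ₜ* H.obj := f.hom.hom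

/-- The two sides of `hφ` are continuous homomorphisms in the generator, so the relation extends to
all of `G_Γ`; this is the compatibility that a map out of a semidirect product requires. -/
theorem exists_semidirect_desc (h : IsDeltaAction Γ z δ) (G : ProTwoGrp.{u})
    (φ : RAAG Γ →ₜ* G.obj) (t : G.obj) (ht : t * t = 1)
    (hφ : ∀ v, t * φ (RAAG.gen v) * t⁻¹ = φ (h.toHom (RAAG.gen v))) :
    ∃ f : semidirect h ⟶ G,
      (∀ g, toCont f (ofRAAG h g) = φ g) ∧ toCont f (ofDelta h x₀) = t := by
  have hφ' : ∀ g, t * φ g * t⁻¹ = φ (h.toHom g) :=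
    DFunLike.congr_fun (f := (conjHom t).comp φ) (g := φ.comp h.toHom) (RAAG.hom_ext hφ)
  have hd : ∀ d, φ.toMonoidHom.comp (δ d).toMonoidHom =
      (MulAut.conj (Delta.lift t ht d)).toMonoidHom.comp φ.toMonoidHom := fun d => by
    ext g
    rcases Delta.eq_one_or_eq d with rfl | rfl
    · simp
    · rw [Delta.lift_x₀]
      exact (hφ' g).symm
  let ψ : RAAG Γ ⋊[δ] Delta →* G.obj :=
    SemidirectProduct.lift φ.toMonoidHom (Delta.lift t ht) hd
  have hψ : Continuous ψ :=
    (φ.continuous_toFun.comp (continuous_left δ)).mul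
      ((continuous_of_discreteTopology (f := Delta.lift t ht)).comp (continuous_right δ))
  let Ψ : (semidirect h).obj →ₜ* G.obj := ⟨ψ, hψ⟩
  refine ⟨ObjectProperty.homMk (ConcreteCategory.ofHom Ψ), fun g => ?_, ?_⟩
  · exact SemidirectProduct.lift_inl φ.toMonoidHom _ hd g
  · exact (SemidirectProduct.lift_inr φ.toMonoidHom _ hd x₀).trans (Delta.lift_x₀ t ht)

theorem semidirect_hom_ext (h : IsDeltaAction Γ z δ) {G : ProTwoGrp.{u}} {f g : semidirect h ⟶ G}
    (hgen : ∀ v, toCont f (ofRAAG h (RAAG.gen v)) = toCont g (ofRAAG h (RAAG.gen v)))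
    (hx : toCont f (ofDelta h x₀) = toCont g (ofDelta h x₀)) : f = g := by
  have hR : (toCont f).comp (ofRAAGHom h) = (toCont g).comp (ofRAAGHom h) := RAAG.hom_ext hgen
  refine ObjectProperty.hom_ext _ (ProfiniteGrp.hom_ext ?_)
  have key : (toCont f).toMonoidHom = (toCont g).toMonoidHom := by
    refine SemidirectProduct.hom_ext (G := Delta) (N := RAAG Γ) (φ := δ)
      (MonoidHom.ext fun r => DFunLike.congr_fun hR r) (MonoidHom.ext fun d => ?_)
    rcases Delta.eq_one_or_eq d with rfl | rfl
    · simp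
    · exact hx
  exact DFunLike.ext _ _ fun s => DFunLike.congr_fun key s

end Extension

/-! ### Binary coproducts in a general category. -/

theorem nonempty_isColimit_binaryCofan {C : Type*} [Category* C] {X Y W : C} {j₁ : X ⟶ W}
    {j₂ : Y ⟶ W} (h : ∀ (T : C) (f : X ⟶ T) (g : Y ⟶ T), ∃! l, j₁ ≫ l = f ∧ j₂ ≫ l = g) :
    Nonempty (IsColimit (BinaryCofan.mk j₁ j₂)) :=
  ⟨BinaryCofan.IsColimit.mk _ (fun f g => (h _ f g).choose)
    (fun f g => (h _ f g).choose_spec.1.1) (fun f g => (h _ f g).choose_spec.1.2)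
    (fun f g m hf hg => (h _ f g).choose_spec.2 m ⟨hf, hg⟩)⟩

theorem nonempty_isColimit_binaryCofan_of_iso {C : Type*} [Category* C] {X Y X' Y' W : C}
    {j₁ : X ⟶ W} {j₂ : Y ⟶ W} (h : IsColimit (BinaryCofan.mk j₁ j₂)) (e₁ : X' ≅ X) (e₂ : Y' ≅ Y) :
    Nonempty (IsColimit (BinaryCofan.mk (e₁.hom ≫ j₁) (e₂.hom ≫ j₂))) := by
  refine nonempty_isColimit_binaryCofan fun T f g => ?_
  let l : {l : W ⟶ T // j₁ ≫ l = e₁.inv ≫ f ∧ j₂ ≫ l = e₂.inv ≫ g} :=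
    BinaryCofan.IsColimit.desc' h _ _
  refine ⟨l.1, ⟨by simp [l.2.1], by simp [l.2.2]⟩, fun m hm => ?_⟩
  refine BinaryCofan.IsColimit.hom_ext h (?_ : j₁ ≫ m = j₁ ≫ l.1) (?_ : j₂ ≫ m = j₂ ≫ l.1)
  · rw [l.2.1, ← hm.1, Category.assoc, Iso.inv_hom_id_assoc]
  · rw [l.2.2, ← hm.2, Category.assoc, Iso.inv_hom_id_assoc]

/-! ### The explicit coproduct of two Δ-RAAGs. -/

section Coproduct

variable {V₁ V₂ : Type u} {Γ₁ : SimpleGraph V₁} {Γ₂ : SimpleGraph V₂}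
  {z₁ : V₁ → RAAG Γ₁} {z₂ : V₂ → RAAG Γ₂}
  {δ₁ : Delta →* MulAut (RAAG Γ₁)} {δ₂ : Delta →* MulAut (RAAG Γ₂)}

/-- The map `G_{Γ₁} → G_{Γ₁ ∐ Γ₂ ∐ Γ₀}`. -/
abbrev mapOne (Γ₁ : SimpleGraph V₁) (Γ₂ : SimpleGraph V₂) :
    RAAG Γ₁ →ₜ* RAAG (unionGraph Γ₁ Γ₂) := RAAG.map (inclOne Γ₁ Γ₂)

/-- The map `G_{Γ₂} → G_{Γ₁ ∐ Γ₂ ∐ Γ₀}`. -/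
abbrev mapTwo (Γ₁ : SimpleGraph V₁) (Γ₂ : SimpleGraph V₂) :
    RAAG Γ₂ →ₜ* RAAG (unionGraph Γ₁ Γ₂) := RAAG.map (inclTwo Γ₁ Γ₂)

theorem mapOne_gen (v : V₁) : mapOne Γ₁ Γ₂ (RAAG.gen v) = RAAG.gen (Sum.inl (Sum.inl v)) :=
  RAAG.map_gen _ _

theorem mapTwo_gen (v : V₂) : mapTwo Γ₁ Γ₂ (RAAG.gen v) = RAAG.gen (Sum.inl (Sum.inr v)) :=
  RAAG.map_gen _ _

/-- Stated for any `σ` given by the tuple on generators, so that it serves both before `σ` is known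
to be an involution and later for `δ(x₀)`. -/
theorem apply_mapOne (h₁ : IsDeltaAction Γ₁ z₁ δ₁)
    {σ : RAAG (unionGraph Γ₁ Γ₂) →ₜ* RAAG (unionGraph Γ₁ Γ₂)}
    (hσ : ∀ v, σ (RAAG.gen v) =
      (coprodTuple z₁ z₂ v)⁻¹ * (RAAG.gen v)⁻¹ * coprodTuple z₁ z₂ v) (g : RAAG Γ₁) :
    σ (mapOne Γ₁ Γ₂ g) = mapOne Γ₁ Γ₂ (h₁.toHom g) := by
  refine DFunLike.congr_fun (f := σ.comp (mapOne Γ₁ Γ₂)) (g := (mapOne Γ₁ Γ₂).comp h₁.toHom)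
    (RAAG.hom_ext fun v => ?_) g
  change σ (mapOne Γ₁ Γ₂ (RAAG.gen v)) = mapOne Γ₁ Γ₂ (h₁.toHom (RAAG.gen v))
  rw [mapOne_gen, hσ, h₁.toHom_gen, map_mul, map_mul, map_inv, map_inv, mapOne_gen]
  rfl

/-- The factor `z⁻¹` appended to each `z₂ⱼ` turns into conjugation by `z`. -/
theorem apply_mapTwo (h₂ : IsDeltaAction Γ₂ z₂ δ₂)
    {σ : RAAG (unionGraph Γ₁ Γ₂) →ₜ* RAAG (unionGraph Γ₁ Γ₂)}
    (hσ : ∀ v, σ (RAAG.gen v) =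
      (coprodTuple z₁ z₂ v)⁻¹ * (RAAG.gen v)⁻¹ * coprodTuple z₁ z₂ v) (g : RAAG Γ₂) :
    σ (mapTwo Γ₁ Γ₂ g) =
      newGen Γ₁ Γ₂ * mapTwo Γ₁ Γ₂ (h₂.toHom g) * (newGen Γ₁ Γ₂)⁻¹ := by
  refine DFunLike.congr_fun (f := σ.comp (mapTwo Γ₁ Γ₂))
    (g := (conjHom (newGen Γ₁ Γ₂)).comp ((mapTwo Γ₁ Γ₂).comp h₂.toHom))
    (RAAG.hom_ext fun v => ?_) g
  change σ (mapTwo Γ₁ Γ₂ (RAAG.gen v)) =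
    newGen Γ₁ Γ₂ * mapTwo Γ₁ Γ₂ (h₂.toHom (RAAG.gen v)) * (newGen Γ₁ Γ₂)⁻¹
  rw [mapTwo_gen, hσ, h₂.toHom_gen, map_mul, map_mul, map_inv, map_inv, mapTwo_gen]
  change (mapTwo Γ₁ Γ₂ (z₂ v) * (newGen Γ₁ Γ₂)⁻¹)⁻¹ * _ *
    (mapTwo Γ₁ Γ₂ (z₂ v) * (newGen Γ₁ Γ₂)⁻¹) = _
  group

theorem apply_newGen
    {σ : RAAG (unionGraph Γ₁ Γ₂) →ₜ* RAAG (unionGraph Γ₁ Γ₂)}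
    (hσ : ∀ v, σ (RAAG.gen v) =
      (coprodTuple z₁ z₂ v)⁻¹ * (RAAG.gen v)⁻¹ * coprodTuple z₁ z₂ v) :
    σ (newGen Γ₁ Γ₂) = (newGen Γ₁ Γ₂)⁻¹ := by
  rw [newGen, hσ]
  change 1⁻¹ * _ * 1 = _
  simp

theorem exists_coprod_action (h₁ : IsDeltaAction Γ₁ z₁ δ₁) (h₂ : IsDeltaAction Γ₂ z₂ δ₂) :
    ∃ δ, IsDeltaAction (unionGraph Γ₁ Γ₂) (coprodTuple z₁ z₂) δ := by
  have e₁ : ∀ v, (coprodTuple z₁ z₂ (Sum.inl (Sum.inl v)))⁻¹ *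
      (RAAG.gen (Sum.inl (Sum.inl v)))⁻¹ * coprodTuple z₁ z₂ (Sum.inl (Sum.inl v)) =
      mapOne Γ₁ Γ₂ (h₁.toHom (RAAG.gen v)) := fun v => by
    rw [h₁.toHom_gen, map_mul, map_mul, map_inv, map_inv, mapOne_gen]
    rfl
  have e₂ : ∀ v, (coprodTuple z₁ z₂ (Sum.inl (Sum.inr v)))⁻¹ *
      (RAAG.gen (Sum.inl (Sum.inr v)))⁻¹ * coprodTuple z₁ z₂ (Sum.inl (Sum.inr v)) =
      conjHom (newGen Γ₁ Γ₂) (mapTwo Γ₁ Γ₂ (h₂.toHom (RAAG.gen v))) := fun v => by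
    rw [conjHom_apply, h₂.toHom_gen, map_mul, map_mul, map_inv, map_inv, mapTwo_gen]
    change (mapTwo Γ₁ Γ₂ (z₂ v) * (newGen Γ₁ Γ₂)⁻¹)⁻¹ * _ *
      (mapTwo Γ₁ Γ₂ (z₂ v) * (newGen Γ₁ Γ₂)⁻¹) = _
    group
  obtain ⟨σ, hσ⟩ := RAAG.exists_lift (Γ := unionGraph Γ₁ Γ₂)
    (RAAG.isPGroup (unionGraph Γ₁ Γ₂))
    (fun v => (coprodTuple z₁ z₂ v)⁻¹ * (RAAG.gen v)⁻¹ * coprodTuple z₁ z₂ v) (by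
      -- Every edge lies inside `Γ₁` or `Γ₂`, where the assignment is `δ₁(x₀)`, or `δ₂(x₀)` followed
      -- by conjugation by `z`; homomorphisms preserve commutation.
      rintro ((u | u) | u) ((v | v) | v) huv
      · rw [e₁, e₁]
        exact ((RAAG.gen_commute (Γ := Γ₁) huv).map h₁.toHom).map (mapOne Γ₁ Γ₂)
      · cases huv
      · cases huv
      · cases huv
      · rw [e₂, e₂]
        exact (((RAAG.gen_commute (Γ := Γ₂) huv).map h₂.toHom).map (mapTwo Γ₁ Γ₂)).map
          (conjHom (newGen Γ₁ Γ₂))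
      all_goals cases huv)
  refine exists_action_of_involution σ hσ ?_
  rintro ((v | v) | v)
  · rw [← mapOne_gen, apply_mapOne h₁ hσ, apply_mapOne h₁ hσ, h₁.toHom_toHom]
  -- The second application conjugates by `z` and by `σ(z) = z⁻¹`, which cancel.
  · rw [← mapTwo_gen, apply_mapTwo h₂ hσ, map_mul, map_mul, map_inv, apply_newGen hσ,
      apply_mapTwo h₂ hσ, h₂.toHom_toHom]
    group
  · change σ (σ (newGen Γ₁ Γ₂)) = newGen Γ₁ Γ₂
    rw [apply_newGen hσ, map_inv, apply_newGen hσ, inv_inv]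

theorem exists_isColimit_binaryCofan (h₁ : IsDeltaAction Γ₁ z₁ δ₁) (h₂ : IsDeltaAction Γ₂ z₂ δ₂)
    {δ : Delta →* MulAut (RAAG (unionGraph Γ₁ Γ₂))}
    (h : IsDeltaAction (unionGraph Γ₁ Γ₂) (coprodTuple z₁ z₂) δ) :
    ∃ (j₁ : semidirect h₁ ⟶ semidirect h) (j₂ : semidirect h₂ ⟶ semidirect h),
      Nonempty (IsColimit (BinaryCofan.mk j₁ j₂)) ∧
      (∀ g, toCont j₁ (ofRAAG h₁ g) = ofRAAG h (mapOne Γ₁ Γ₂ g)) ∧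
      toCont j₁ (ofDelta h₁ x₀) = ofDelta h x₀ ∧
      (∀ g, toCont j₂ (ofRAAG h₂ g) = ofRAAG h (mapTwo Γ₁ Γ₂ g)) ∧
      toCont j₂ (ofDelta h₂ x₀) = ofDelta h x₀ * ofRAAG h (newGen Γ₁ Γ₂) := by
  have hz : ofDelta h x₀ * ofRAAG h (newGen Γ₁ Γ₂) * (ofDelta h x₀)⁻¹ =
      (ofRAAG h (newGen Γ₁ Γ₂))⁻¹ := by
    rw [ofDelta_conj, apply_newGen h.toHom_gen, map_inv]
  have hx : (ofDelta h x₀)⁻¹ = ofDelta h x₀ := inv_eq_of_mul_eq_one_right (ofDelta_mul_self h)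
  obtain ⟨j₁, hj₁, hj₁'⟩ := exists_semidirect_desc h₁ (semidirect h)
    ((ofRAAGHom h).comp (mapOne Γ₁ Γ₂)) (ofDelta h x₀) (ofDelta_mul_self h) (fun v => by
      change _ * ofRAAG h (mapOne Γ₁ Γ₂ _) * _ = ofRAAG h (mapOne Γ₁ Γ₂ _)
      rw [ofDelta_conj, apply_mapOne h₁ h.toHom_gen])
  -- The image `x₁₀z` of `x₂₀` comes from solving `z = x₁₀x₂₀`. Its square is `(x₁₀zx₁₀)z = z⁻¹z =
  -- 1`.
  obtain ⟨j₂, hj₂, hj₂'⟩ := exists_semidirect_desc h₂ (semidirect h)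
    ((ofRAAGHom h).comp (mapTwo Γ₁ Γ₂)) (ofDelta h x₀ * ofRAAG h (newGen Γ₁ Γ₂)) (by
      rw [hx] at hz
      rw [← mul_assoc, hz, inv_mul_cancel]) (fun v => by
      change _ * ofRAAG h (mapTwo Γ₁ Γ₂ _) * _ = ofRAAG h (mapTwo Γ₁ Γ₂ _)
      have : ofDelta h x₀ * ofRAAG h (newGen Γ₁ Γ₂) = (ofRAAG h (newGen Γ₁ Γ₂))⁻¹ * ofDelta h x₀ :=
        mul_inv_eq_iff_eq_mul.1 hz
      rw [this]
      -- With `x₁₀z = z⁻¹x₁₀`, the outer conjugation by `z⁻¹` undoes the twist by `z` in the action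
      -- of `x₁₀`.
      calc _ = (ofRAAG h (newGen Γ₁ Γ₂))⁻¹ *
            (ofDelta h x₀ * ofRAAG h (mapTwo Γ₁ Γ₂ (RAAG.gen v)) * (ofDelta h x₀)⁻¹) *
            ofRAAG h (newGen Γ₁ Γ₂) := by group
        _ = _ := by
          rw [ofDelta_conj, apply_mapTwo h₂ h.toHom_gen, map_mul, map_mul, map_inv]
          group)
  have hj₁ : ∀ g, toCont j₁ (ofRAAG h₁ g) = ofRAAG h (mapOne Γ₁ Γ₂ g) := hj₁
  have hj₂ : ∀ g, toCont j₂ (ofRAAG h₂ g) = ofRAAG h (mapTwo Γ₁ Γ₂ g) := hj₂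
  refine ⟨j₁, j₂, ?_, hj₁, hj₁', hj₂, hj₂'⟩
  have key : ∀ (T : ProTwoGrp.{u}) (f₁ : semidirect h₁ ⟶ T) (f₂ : semidirect h₂ ⟶ T),
      ∃! f : semidirect h ⟶ T, j₁ ≫ f = f₁ ∧ j₂ ≫ f = f₂ := by
    intro T f₁ f₂
    obtain ⟨φ, hφ⟩ := RAAG.exists_lift (Γ := unionGraph Γ₁ Γ₂) T.property
      (fun v => match v with
        | Sum.inl (Sum.inl i) => toCont f₁ (ofRAAG h₁ (RAAG.gen i))
        | Sum.inl (Sum.inr j) => toCont f₂ (ofRAAG h₂ (RAAG.gen j))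
        | Sum.inr _ => toCont f₁ (ofDelta h₁ x₀) * toCont f₂ (ofDelta h₂ x₀)) (by
      rintro ((u | u) | u) ((v | v) | v) huv
      · exact ((RAAG.gen_commute (Γ := Γ₁) huv).map (ofRAAG h₁)).map (toCont f₁)
      · cases huv
      · cases huv
      · cases huv
      · exact ((RAAG.gen_commute (Γ := Γ₂) huv).map (ofRAAG h₂)).map (toCont f₂)
      all_goals cases huv)
    have hφ₁ : ∀ g, φ (mapOne Γ₁ Γ₂ g) = toCont f₁ (ofRAAG h₁ g) := by
      refine DFunLike.congr_fun (f := φ.comp (mapOne Γ₁ Γ₂))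
        (g := (toCont f₁).comp (ofRAAGHom h₁)) (RAAG.hom_ext fun v => ?_)
      change φ (mapOne Γ₁ Γ₂ _) = _
      rw [mapOne_gen, hφ]
      rfl
    have hφ₂ : ∀ g, φ (mapTwo Γ₁ Γ₂ g) = toCont f₂ (ofRAAG h₂ g) := by
      refine DFunLike.congr_fun (f := φ.comp (mapTwo Γ₁ Γ₂))
        (g := (toCont f₂).comp (ofRAAGHom h₂)) (RAAG.hom_ext fun v => ?_)
      change φ (mapTwo Γ₁ Γ₂ _) = _
      rw [mapTwo_gen, hφ]
      rfl
    have hφz : φ (newGen Γ₁ Γ₂) = toCont f₁ (ofDelta h₁ x₀) * toCont f₂ (ofDelta h₂ x₀) := hφ _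
    have ht₁ : toCont f₁ (ofDelta h₁ x₀) * toCont f₁ (ofDelta h₁ x₀) = 1 := by
      rw [← map_mul, ofDelta_mul_self, map_one]
    have ht₂ : toCont f₂ (ofDelta h₂ x₀) * toCont f₂ (ofDelta h₂ x₀) = 1 := by
      rw [← map_mul, ofDelta_mul_self, map_one]
    have hi₁ := inv_eq_of_mul_eq_one_right ht₁
    have hi₂ := inv_eq_of_mul_eq_one_right ht₂
    obtain ⟨f, hf, hf'⟩ := exists_semidirect_desc h T φ (toCont f₁ (ofDelta h₁ x₀)) ht₁ (by
      rintro ((v | v) | v)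
      · rw [← mapOne_gen, apply_mapOne h₁ h.toHom_gen, hφ₁, hφ₁, ← map_inv, ← map_mul,
          ← map_mul, ofDelta_conj]
      -- Write `a`, `b` for the images of `x₁₀`, `x₂₀`. The right side is `(ab)(b f₂(g) b)(ab)⁻¹`,
      -- and `b² = 1` reduces it to `a f₂(g) a⁻¹`.
      · rw [← mapTwo_gen, apply_mapTwo h₂ h.toHom_gen, map_mul, map_mul, map_inv, hφ₂, hφ₂,
          hφz, ← ofDelta_conj, map_mul, map_mul, map_inv, mul_inv_rev, hi₂]
        simp only [mul_assoc]
        rw [← mul_assoc (toCont f₂ (ofDelta h₂ x₀)) (toCont f₂ (ofDelta h₂ x₀)), ht₂, one_mul,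
          ← mul_assoc (toCont f₂ (ofDelta h₂ x₀)) (toCont f₂ (ofDelta h₂ x₀)), ht₂, one_mul]
      -- Here the relation is `a(ab)a⁻¹ = ba = (ab)⁻¹`.
      · change _ * φ (newGen Γ₁ Γ₂) * _ = φ (h.toHom (newGen Γ₁ Γ₂))
        rw [apply_newGen h.toHom_gen, map_inv, hφz, mul_inv_rev, hi₁, hi₂, ← mul_assoc, ht₁,
          one_mul])
    refine ⟨f, ⟨?_, ?_⟩, ?_⟩
    · refine semidirect_hom_ext h₁ (fun v => ?_) ?_
      · change toCont f (toCont j₁ _) = _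
        rw [hj₁, ← hφ₁]
        exact hf _
      · change toCont f (toCont j₁ _) = _
        rw [hj₁', hf']
    · refine semidirect_hom_ext h₂ (fun v => ?_) ?_
      · change toCont f (toCont j₂ _) = _
        rw [hj₂, ← hφ₂]
        exact hf _
      · change toCont f (toCont j₂ _) = _
        rw [hj₂', map_mul, hf', hf, hφz, ← mul_assoc, ht₁, one_mul]
    · rintro g ⟨hg₁, hg₂⟩
      have hg₁' : ∀ s, toCont g (toCont j₁ s) = toCont f₁ s := fun s => by rw [← hg₁]; rfl
      have hg₂' : ∀ s, toCont g (toCont j₂ s) = toCont f₂ s := fun s => by rw [← hg₂]; rfl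
      have hgx : toCont g (ofDelta h x₀) = toCont f₁ (ofDelta h₁ x₀) := by rw [← hg₁', hj₁']
      refine semidirect_hom_ext h ?_ (by rw [hf', hgx])
      rintro ((v | v) | v)
      · rw [hf, ← mapOne_gen, hφ₁, ← hj₁, hg₁']
      · rw [hf, ← mapTwo_gen, hφ₂, ← hj₂, hg₂']
      -- The value at `z` is forced because `z = x₁₀ · (x₁₀z)` is a product of elements from the
      -- images of `j₁` and `j₂`.
      · change toCont g (ofRAAG h (newGen Γ₁ Γ₂)) = toCont f (ofRAAG h (newGen Γ₁ Γ₂))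
        rw [hf, hφz, ← hgx, ← hg₂', hj₂', map_mul, ← mul_assoc, ← map_mul, ofDelta_mul_self,
          map_one, one_mul]
  exact nonempty_isColimit_binaryCofan key

end Coproduct

/-! ### Nonempty finite coproducts. -/

theorem IsDeltaRAAG.of_iso {G H : ProTwoGrp.{u}} (e : G ≅ H) (hG : IsDeltaRAAG G) :
    IsDeltaRAAG H := by
  obtain ⟨V, hV, Γ, z, δ, h, ⟨i⟩⟩ := hG
  exact ⟨V, hV, Γ, z, δ, h, ⟨e.symm ≪≫ i⟩⟩

theorem IsDeltaRAAG.exists_binaryCoproduct {G H : ProTwoGrp.{u}} (hG : IsDeltaRAAG G)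
    (hH : IsDeltaRAAG H) :
    ∃ c : BinaryCofan G H, Nonempty (IsColimit c) ∧ IsDeltaRAAG c.pt := by
  obtain ⟨V₁, _, Γ₁, z₁, δ₁, h₁, ⟨i₁⟩⟩ := hG
  obtain ⟨V₂, _, Γ₂, z₂, δ₂, h₂, ⟨i₂⟩⟩ := hH
  obtain ⟨δ, h⟩ := exists_coprod_action h₁ h₂
  obtain ⟨j₁, j₂, ⟨hj⟩, -⟩ := exists_isColimit_binaryCofan h₁ h₂ h
  exact ⟨BinaryCofan.mk (i₁.hom ≫ j₁) (i₂.hom ≫ j₂),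
    nonempty_isColimit_binaryCofan_of_iso hj i₁ i₂, _, inferInstance, _, _, δ, h, ⟨Iso.refl _⟩⟩

/-- Induction splits off the member at `0`. It starts from one member: the empty coproduct is the
trivial group, which is not a Δ-RAAG. -/
theorem exists_coproduct_fin (n : ℕ) (X : Fin (n + 1) → ProTwoGrp.{u})
    (hX : ∀ i, IsDeltaRAAG (X i)) :
    ∃ c : Cofan X, Nonempty (IsColimit c) ∧ IsDeltaRAAG c.pt := by
  induction n with
  | zero =>
    exact ⟨Cofan.mk (f := X) (X 0) (fun i => eqToHom (congrArg X (Fin.fin_one_eq_zero i))),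
      ⟨Cofan.IsColimit.mk _ (fun t => t.inj 0)
        (fun t i => by
          obtain rfl := Fin.fin_one_eq_zero i
          exact Category.id_comp _)
        (fun t m hm => by
          rw [← hm 0]
          exact (Category.id_comp m).symm)⟩, hX 0⟩
  | succ n ih =>
    obtain ⟨c₁, ⟨hc₁⟩, h₁⟩ := ih (fun i => X i.succ) (fun i => hX i.succ)
    obtain ⟨c₂, ⟨hc₂⟩, h₂⟩ := (hX 0).exists_binaryCoproduct h₁
    exact ⟨extendCofan c₁ c₂, ⟨extendCofanIsColimit X hc₁ hc₂⟩, h₂⟩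

theorem exists_coproduct {ι : Type w} [Finite ι] [Nonempty ι] (X : ι → ProTwoGrp.{u})
    (hX : ∀ i, IsDeltaRAAG (X i)) :
    ∃ c : Cofan X, Nonempty (IsColimit c) ∧ IsDeltaRAAG c.pt := by
  obtain ⟨n, ⟨e⟩⟩ := Finite.exists_equiv_fin ι
  obtain _ | n := n
  · exact (e (Classical.arbitrary ι)).elim0
  -- Making `X` literally a composite with `e` allows the cofan to be reindexed without transport
  -- along isomorphisms.
  obtain ⟨Y, rfl⟩ : ∃ Y : Fin (n + 1) → ProTwoGrp.{u}, X = Y ∘ e :=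
    ⟨X ∘ e.symm, by rw [Function.comp_assoc, Equiv.symm_comp_self, Function.comp_id]⟩
  obtain ⟨c, ⟨hc⟩, h⟩ := exists_coproduct_fin n Y fun j => by simpa using hX (e.symm j)
  exact ⟨_, ⟨Cofan.isColimitEquivOfEquiv e c hc⟩, h⟩

end DeltaRAAG

theorem mainTheorem4 :
    -- the class of Δ-RAAGs is stable under (nonempty) finite coproducts of pro-2 groups
    (∀ (ι : Type w) [Finite ι] [Nonempty ι] (X : ι → DeltaRAAG.ProTwoGrp.{u}),
      (∀ i, DeltaRAAG.IsDeltaRAAG (X i)) →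
        HasCoproduct X ∧
          ∀ c : Cofan X, Nonempty (IsColimit c) → DeltaRAAG.IsDeltaRAAG c.pt) ∧
    -- the explicit description of the coproduct of two Δ-RAAGs
    (∀ (V₁ V₂ : Type u) [Finite V₁] [Finite V₂]
      (Γ₁ : SimpleGraph V₁) (Γ₂ : SimpleGraph V₂)
      (z₁ : V₁ → DeltaRAAG.RAAG Γ₁) (z₂ : V₂ → DeltaRAAG.RAAG Γ₂)
      (δ₁ : DeltaRAAG.Delta →* MulAut (DeltaRAAG.RAAG Γ₁))
      (δ₂ : DeltaRAAG.Delta →* MulAut (DeltaRAAG.RAAG Γ₂))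
      (h₁ : DeltaRAAG.IsDeltaAction Γ₁ z₁ δ₁) (h₂ : DeltaRAAG.IsDeltaAction Γ₂ z₂ δ₂),
      ∃ (δ : DeltaRAAG.Delta →* MulAut (DeltaRAAG.RAAG (DeltaRAAG.unionGraph Γ₁ Γ₂)))
        (h : DeltaRAAG.IsDeltaAction (DeltaRAAG.unionGraph Γ₁ Γ₂)
          (DeltaRAAG.coprodTuple z₁ z₂) δ),
        HasBinaryCoproduct (DeltaRAAG.semidirect h₁) (DeltaRAAG.semidirect h₂) ∧
        ∀ (G : DeltaRAAG.ProTwoGrp.{u})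
          (i₁ : DeltaRAAG.semidirect h₁ ⟶ G) (i₂ : DeltaRAAG.semidirect h₂ ⟶ G),
          Nonempty (IsColimit (BinaryCofan.mk i₁ i₂)) →
          ∃ e : DeltaRAAG.semidirect h ≅ G,
            (∀ i : V₁,
              e.hom.hom (DeltaRAAG.ofRAAG h (DeltaRAAG.RAAG.gen (Sum.inl (Sum.inl i)))) =
                i₁.hom (DeltaRAAG.ofRAAG h₁ (DeltaRAAG.RAAG.gen i))) ∧
            (∀ j : V₂,
              e.hom.hom (DeltaRAAG.ofRAAG h (DeltaRAAG.RAAG.gen (Sum.inl (Sum.inr j)))) =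
                i₂.hom (DeltaRAAG.ofRAAG h₂ (DeltaRAAG.RAAG.gen j))) ∧
            e.hom.hom (DeltaRAAG.ofRAAG h (DeltaRAAG.newGen Γ₁ Γ₂)) =
              i₁.hom (DeltaRAAG.ofDelta h₁ DeltaRAAG.x₀) *
                i₂.hom (DeltaRAAG.ofDelta h₂ DeltaRAAG.x₀) ∧
            e.hom.hom (DeltaRAAG.ofDelta h DeltaRAAG.x₀) =
              i₁.hom (DeltaRAAG.ofDelta h₁ DeltaRAAG.x₀)) := by
  refine ⟨fun ι _ _ X hX => ?_, fun V₁ V₂ _ _ Γ₁ Γ₂ z₁ z₂ δ₁ δ₂ h₁ h₂ => ?_⟩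
  · obtain ⟨c, ⟨hc⟩, h⟩ := DeltaRAAG.exists_coproduct X hX
    -- One good coproduct suffices, since any other is isomorphic to it.
    exact ⟨⟨⟨c, hc⟩⟩, fun c' ⟨hc'⟩ => h.of_iso (hc.coconePointUniqueUpToIso hc')⟩
  · obtain ⟨δ, h⟩ := DeltaRAAG.exists_coprod_action h₁ h₂
    obtain ⟨j₁, j₂, ⟨hj⟩, h₁g, h₁x, h₂g, h₂x⟩ :=
      DeltaRAAG.exists_isColimit_binaryCofan h₁ h₂ h
    refine ⟨δ, h, ⟨⟨_, hj⟩⟩, fun G i₁ i₂ ⟨hi⟩ => ?_⟩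
    let e : DeltaRAAG.semidirect h ≅ G := hj.coconePointUniqueUpToIso hi
    have he₁ : j₁ ≫ e.hom = i₁ := hj.comp_coconePointUniqueUpToIso_hom hi ⟨WalkingPair.left⟩
    have he₂ : j₂ ≫ e.hom = i₂ := hj.comp_coconePointUniqueUpToIso_hom hi ⟨WalkingPair.right⟩
    have he₁' : ∀ s, DeltaRAAG.toCont e.hom (DeltaRAAG.toCont j₁ s) = DeltaRAAG.toCont i₁ s :=
      fun s => by rw [← he₁]; rfl
    have he₂' : ∀ s, DeltaRAAG.toCont e.hom (DeltaRAAG.toCont j₂ s) = DeltaRAAG.toCont i₂ s :=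
      fun s => by rw [← he₂]; rfl
    refine ⟨e, fun i => ?_, fun j => ?_, ?_, ?_⟩
    · change DeltaRAAG.toCont e.hom _ = DeltaRAAG.toCont i₁ _
      rw [← he₁', h₁g, DeltaRAAG.mapOne_gen]
    · change DeltaRAAG.toCont e.hom _ = DeltaRAAG.toCont i₂ _
      rw [← he₂', h₂g, DeltaRAAG.mapTwo_gen]
    · change DeltaRAAG.toCont e.hom _ = DeltaRAAG.toCont i₁ _ * DeltaRAAG.toCont i₂ _
      -- Pulled back along `e`, the right side is `x₁₀ · (x₁₀z) = z`.
      rw [← he₁', ← he₂', h₁x, h₂x, ← map_mul, ← mul_assoc, DeltaRAAG.ofDelta_mul_self, one_mul]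
    · change DeltaRAAG.toCont e.hom _ = DeltaRAAG.toCont i₁ _
      rw [← he₁', h₁x]
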